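/- Let $X$ be a real Banach space, and let $\tau=\tau(X^*,X)$ be the Mackey topology on $X^*$, i.e. the topology of uniform convergence on the weakly compact absolutely convex subsets of $X$. Let $\tau^0$ be the topology on $X^{**}$ of uniform convergence on the $\tau$-precompact (i.e. totally bounded with respect to $\tau$) subsets of $X^*$. Suppose that $\tau^0$ agrees with $\sigma(X^{**},X^*)$ on the bounded subsets of $X^{**}$, i.e. that on every norm-bounded subset of $X^{**}$ the two topologies induce the same subspace topology. Then $$\tau^0=\|\cdot\|_c=\|\cdot\|^n \quad\text{on } X^{**},$$ where $\|\cdot\|_c$ is the topology of uniform convergence on the norm-compact subsets of $X^*$, and $\|\cdot\|^n$ is the topology of uniform convergence on the norm-null sequences in $X^*$ (i.e. on the sets $\{x_n^*:n\in\mathbb N\}$ with $\|x_n^*\|\to 0$). -/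

import Mathlib

open Topology Filter

noncomputable section

namespace MackeyBidual

/-- The uniform structure of uniform convergence on the members of `𝔖`, on the dual `E*` of a real
normed space `E`, where `𝔖` is a family of subsets of `E`. -/
@[reducible] def uniformConvOn {E : Type*} [NormedAddCommGroup E] [NormedSpace ℝ E] (𝔖 : Set (Set E)) :
    UniformSpace (StrongDual ℝ E) :=
  (UniformConvergenceCLM.instUniformSpace (RingHom.id ℝ) ℝ 𝔖).comap
    (UniformConvergenceCLM.ofFun (RingHom.id ℝ) ℝ 𝔖)

/-- The topology on `E*` of uniform convergence on the members of `𝔖`. -/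
@[reducible] def uniformConvTopology {E : Type*} [NormedAddCommGroup E] [NormedSpace ℝ E] (𝔖 : Set (Set E)) :
    TopologicalSpace (StrongDual ℝ E) :=
  (uniformConvOn 𝔖).toTopologicalSpace

/-- The Mackey topology `τ(X*, X)` on `X*`, with its (translation invariant) uniform structure:
uniform convergence on the weakly compact absolutely convex subsets of `X`. -/
@[reducible] def mackey (X : Type*) [NormedAddCommGroup X] [NormedSpace ℝ X] : UniformSpace (StrongDual ℝ X) :=
  uniformConvOn {K : Set X | AbsConvex ℝ K ∧ IsCompact (toWeakSpace ℝ X '' K)}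

/-- The topology `τ⁰` on `X**`: uniform convergence on the precompact (that is, totally bounded)
subsets of `(X*, τ(X*, X))`. -/
@[reducible] def tauZero (X : Type*) [NormedAddCommGroup X] [NormedSpace ℝ X] :
    TopologicalSpace (StrongDual ℝ (StrongDual ℝ X)) :=
  uniformConvTopology {P : Set (StrongDual ℝ X) | @TotallyBounded _ (mackey X) P}

/-- The topology `‖·‖_c` on `X**`: uniform convergence on the norm-compact subsets of `X*`. -/
@[reducible] def normC (X : Type*) [NormedAddCommGroup X] [NormedSpace ℝ X] :
    TopologicalSpace (StrongDual ℝ (StrongDual ℝ X)) :=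
  uniformConvTopology {K : Set (StrongDual ℝ X) | IsCompact K}

/-- The topology `‖·‖ⁿ` on `X**`: uniform convergence on the (ranges of the) norm-null sequences
in `X*`. -/
@[reducible] def normN (X : Type*) [NormedAddCommGroup X] [NormedSpace ℝ X] :
    TopologicalSpace (StrongDual ℝ (StrongDual ℝ X)) :=
  uniformConvTopology
    {S : Set (StrongDual ℝ X) | ∃ u : ℕ → StrongDual ℝ X, Tendsto u atTop (𝓝 0) ∧ Set.range u = S}

/-- The weak-star topology `σ(X**, X*)` on `X**`. -/
@[reducible] def weakStar (X : Type*) [NormedAddCommGroup X] [NormedSpace ℝ X] :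
    TopologicalSpace (StrongDual ℝ (StrongDual ℝ X)) :=
  TopologicalSpace.induced (fun f => StrongDual.toWeakDual f)
    (inferInstance : TopologicalSpace (WeakDual ℝ (StrongDual ℝ X)))

end MackeyBidual

end

namespace MackeyBidual

/-! ### Comparison of topologies of uniform convergence -/

section Comparison

variable {E : Type*} [NormedAddCommGroup E] [NormedSpace ℝ E]

/-! The norm is finer than the Mackey topology and a null sequence together with 0 is compact, so
`tauZero ≤ normC ≤ normN` (`≤` means finer). To close the cycle, let `P` be Mackey-precompact.
Agreement with the weak-star topology at 0 in the unit ball gives, for each `ε`, a finite `I ⊆ X*`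
such that functionals of norm at most 1 vanishing on `I` are at most `ε` on `P`. By Hahn–Banach, `P`
is then close to `span I`; hence `P` is norm totally bounded (`totallyBounded_of_induced_eq`), and
Grothendieck's lemma (`exists_tendsto_zero_polar_subset`) puts it in the bipolar of a null sequence.
-/

theorem tendsto_uniformConvTopology_iff {ι : Type*} {p : Filter ι} (𝔖 : Set (Set E))
    {a : ι → StrongDual ℝ E} {a₀ : StrongDual ℝ E} :
    Tendsto a p (@nhds _ (uniformConvTopology 𝔖) a₀) ↔
      ∀ S ∈ 𝔖, ∀ ε > 0, ∀ᶠ i in p, ∀ x ∈ S, |a i x - a₀ x| < ε := by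
  have h₁ : @nhds _ (uniformConvTopology 𝔖) a₀ =
      comap (UniformConvergenceCLM.ofFun (RingHom.id ℝ) ℝ 𝔖)
        (𝓝 (UniformConvergenceCLM.ofFun (RingHom.id ℝ) ℝ 𝔖 a₀)) := nhds_induced _ _
  rw [h₁, tendsto_comap_iff, UniformConvergenceCLM.tendsto_iff_tendstoUniformlyOn]
  refine forall₂_congr fun S _ => ?_
  rw [Metric.tendstoUniformlyOn_iff]
  refine forall₂_congr fun ε _ => eventually_congr (Eventually.of_forall fun i => ?_)
  refine forall₂_congr fun x _ => ?_
  rw [dist_comm, Real.dist_eq]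
  rfl

/-- The topology of uniform convergence on `𝔖₁` is finer than that on `𝔖₂` as soon as the polar of
each member of `𝔖₂` contains the polar of a member of `𝔖₁`. -/
theorem uniformConvTopology_le {𝔖₁ 𝔖₂ : Set (Set E)}
    (h : ∀ S ∈ 𝔖₂, ∃ T ∈ 𝔖₁, ∀ φ : StrongDual ℝ E, (∀ x ∈ T, |φ x| ≤ 1) → ∀ x ∈ S, |φ x| ≤ 1) :
    uniformConvTopology 𝔖₁ ≤ uniformConvTopology 𝔖₂ := by
  refine le_of_nhds_le_nhds fun φ => ?_
  refine (tendsto_uniformConvTopology_iff (p := @nhds _ (uniformConvTopology 𝔖₁) φ)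
    (a := id) 𝔖₂).2 fun S hS ε hε => ?_
  obtain ⟨T, hT, hTS⟩ := h S hS
  have := (tendsto_uniformConvTopology_iff (p := @nhds _ (uniformConvTopology 𝔖₁) φ)
    (a := id) 𝔖₁).1 tendsto_id T hT (ε / 2) (half_pos hε)
  filter_upwards [this] with ψ hψ x hx
  have key := hTS ((ε / 2)⁻¹ • (ψ - φ)) (fun y hy => ?_) x hx
  · simp only [smul_apply, sub_apply, smul_eq_mul, abs_mul,
      abs_inv, abs_of_pos (half_pos hε)] at key
    rw [inv_mul_le_iff₀ (half_pos hε)] at key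
    simp only [id]
    linarith
  · simp only [smul_apply, sub_apply, smul_eq_mul, abs_mul,
      abs_inv, abs_of_pos (half_pos hε)]
    rw [inv_mul_le_iff₀ (half_pos hε), mul_one]
    exact (hψ y hy).le

theorem uniformConvTopology_mono {𝔖₁ 𝔖₂ : Set (Set E)} (h : ∀ S ∈ 𝔖₂, ∃ T ∈ 𝔖₁, S ⊆ T) :
    uniformConvTopology 𝔖₁ ≤ uniformConvTopology 𝔖₂ :=
  uniformConvTopology_le fun S hS =>
    let ⟨T, hT, hST⟩ := h S hS
    ⟨T, hT, fun _ hφ x hx => hφ x (hST hx)⟩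

/-- The norm uniformity on the dual is finer than uniform convergence on a family of bounded
sets. -/
theorem norm_uniformSpace_le_uniformConvOn {𝔖 : Set (Set E)}
    (h : ∀ S ∈ 𝔖, Bornology.IsBounded S) :
    (inferInstance : UniformSpace (StrongDual ℝ E)) ≤ uniformConvOn 𝔖 := by
  have hsub : 𝔖 ⊆ {S | Bornology.IsVonNBounded ℝ S} := fun S hS =>
    (NormedSpace.isVonNBounded_iff ℝ).2 (h S hS)
  rintro U ⟨V, hV, hVU⟩
  have hV' : V ∈ @uniformity (StrongDual ℝ E) ContinuousLinearMap.uniformSpace :=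
    UniformConvergenceCLM.uniformSpace_mono (RingHom.id ℝ) ℝ hsub hV
  exact mem_of_superset hV' hVU

/-- Uniform boundedness is applied on the dual, which is always complete. -/
theorem isBounded_of_isCompact_toWeakSpace {K : Set E}
    (hK : IsCompact (toWeakSpace ℝ E '' K)) : Bornology.IsBounded K := by
  have hpt : ∀ f : StrongDual ℝ E, ∃ C, ∀ x : K, ‖NormedSpace.inclusionInDoubleDual ℝ E x f‖ ≤ C := by
    intro f
    have hc : Continuous fun y : WeakSpace ℝ E => topDualPairing ℝ E f y :=
      WeakBilin.eval_continuous (topDualPairing ℝ E).flip f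
    obtain ⟨C, hC⟩ := (hK.image hc).isBounded.exists_norm_le
    refine ⟨C, fun x => ?_⟩
    exact hC _ ⟨_, ⟨x, x.2, rfl⟩, rfl⟩
  obtain ⟨C, hC⟩ := banach_steinhaus hpt
  refine isBounded_iff_forall_norm_le.2 ⟨C, fun x hx => ?_⟩
  simpa [NormedSpace.inclusionInDoubleDual_norm_eq] using
    ((NormedSpace.inclusionInDoubleDualLi ℝ (E := E)).norm_map x).symm.le.trans (hC ⟨x, hx⟩)

end Comparison

/-! ### Null sequences and totally bounded sets -/

section NullSequence

variable {E : Type*} [NormedAddCommGroup E]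

/-- A set with only finitely many members outside each ball around zero is covered by a null
sequence. -/
theorem exists_tendsto_zero_of_finite_norm_ge {S : Set E} (hS : S.Countable)
    (hfin : ∀ ε > 0, {x ∈ S | ε ≤ ‖x‖}.Finite) :
    ∃ u : ℕ → E, Tendsto u atTop (𝓝 0) ∧ S ⊆ Set.range u := by
  classical
  obtain ⟨e, he⟩ := Set.countable_iff_exists_injOn.1 hS
  let u : ℕ → E := fun n => if h : ∃ x ∈ S, e x = n then h.choose else 0
  have hu : ∀ x ∈ S, u (e x) = x := by
    intro x hx
    have h : ∃ y ∈ S, e y = e x := ⟨x, hx, rfl⟩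
    simp only [u, dif_pos h]
    exact he h.choose_spec.1 hx h.choose_spec.2
  refine ⟨u, ?_, fun x hx => ⟨e x, hu x hx⟩⟩
  rw [← Nat.cofinite_eq_atTop, Metric.tendsto_nhds]
  intro ε hε
  refine ((hfin ε hε).image e).subset fun n hn => ?_
  simp only [dist_zero_right, Set.mem_compl_iff, Set.mem_ofPred_eq, not_lt] at hn
  by_cases h : ∃ x ∈ S, e x = n
  · obtain ⟨x, hx, rfl⟩ := h
    rw [hu x hx] at hn
    exact ⟨x, ⟨hx, hn⟩, rfl⟩
  · simp only [u, dif_neg h, norm_zero] at hn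
    exact absurd hn hε.not_ge

/-- Grothendieck: a totally bounded set is contained in the bipolar of a null sequence. -/
theorem exists_tendsto_zero_polar_subset [NormedSpace ℝ E] {K : Set E} (hK : TotallyBounded K) :
    ∃ u : ℕ → E, Tendsto u atTop (𝓝 0) ∧
      ∀ φ : StrongDual ℝ E, (∀ x ∈ Set.range u, |φ x| ≤ 1) → ∀ x ∈ K, |φ x| ≤ 1 := by
  have hnet (n : ℕ) : ∃ t : Set E, t.Finite ∧ ∀ x ∈ K, ∃ y ∈ t, ‖x - y‖ < (1 / 4 : ℝ) ^ n := by
    obtain ⟨t, ht, hKt⟩ := Metric.totallyBounded_iff.1 hK ((1 / 4 : ℝ) ^ n) (by positivity)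
    refine ⟨t, ht, fun x hx => ?_⟩
    obtain ⟨y, hy, hxy⟩ := Set.mem_iUnion₂.1 (hKt hx)
    exact ⟨y, hy, by rwa [← dist_eq_norm]⟩
  choose t ht hKt using hnet
  -- With `a n` in the `n`-th net tending to `x`, `x = (1/2)(2 a 0) + ∑ 2^-(n+2) (2^(n+2) (a (n+1) -
  -- a n))`. The weights sum to 1, while the rescaled differences still have norm `O(2^-n)`.
  let D : ℕ → Set E := fun n =>
    (fun z : E => (2 : ℝ) ^ (n + 2) • z) ''
      ((fun q : E × E => q.1 - q.2) '' (t (n + 1) ×ˢ t n) ∩ {z | ‖z‖ ≤ 2 * (1 / 4 : ℝ) ^ n})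
  have hDfin (n : ℕ) : (D n).Finite :=
    (((((ht (n + 1)).prod (ht n)).image _).inter_of_left _).image _)
  have hDnorm (n : ℕ) : ∀ z ∈ D n, ‖z‖ ≤ 8 * (1 / 2 : ℝ) ^ n := by
    rintro _ ⟨z, ⟨-, hz⟩, rfl⟩
    change ‖z‖ ≤ 2 * (1 / 4 : ℝ) ^ n at hz
    rw [norm_smul, Real.norm_of_nonneg (by positivity)]
    calc (2 : ℝ) ^ (n + 2) * ‖z‖ ≤ 2 ^ (n + 2) * (2 * (1 / 4 : ℝ) ^ n) := by gcongr
      _ = 8 * (2 * (1 / 4)) ^ n := by rw [mul_pow]; ring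
      _ = 8 * (1 / 2 : ℝ) ^ n := by norm_num
  let S : Set E := (fun z : E => (2 : ℝ) • z) '' t 0 ∪ ⋃ n, D n
  have hS : S.Countable :=
    ((ht 0).image _).countable.union (Set.countable_iUnion fun n => (hDfin n).countable)
  obtain ⟨u, hu, hSu⟩ := exists_tendsto_zero_of_finite_norm_ge hS fun ε hε => by
    have hlim : Tendsto (fun n : ℕ => 8 * (1 / 2 : ℝ) ^ n) atTop (𝓝 0) := by
      simpa using (tendsto_pow_atTop_nhds_zero_of_lt_one (r := (1 / 2 : ℝ))
        (by norm_num) (by norm_num)).const_mul 8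
    obtain ⟨N, hN⟩ := eventually_atTop.1 (hlim.eventually_lt_const hε)
    refine (((ht 0).image fun z : E => (2 : ℝ) • z).union
      ((Set.finite_lt_nat N).biUnion fun n _ => hDfin n)).subset ?_
    rintro x ⟨hx | hx, hεx⟩
    · exact Or.inl hx
    · obtain ⟨n, hn⟩ := Set.mem_iUnion.1 hx
      refine Or.inr (Set.mem_biUnion (x := n) ?_ hn)
      by_contra hnN
      exact absurd (hεx.trans (hDnorm n x hn)) (hN n (not_lt.1 hnN)).not_ge
  refine ⟨u, hu, fun φ hφ x hx => ?_⟩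
  have hφS : ∀ z ∈ S, |φ z| ≤ 1 := fun z hz => hφ z (hSu hz)
  choose a hat hax using fun n => hKt n x hx
  -- The right side is the sum of the weights used up to `a n`.
  have hbound (n : ℕ) : |φ (a n)| ≤ 1 - (1 / 2 : ℝ) ^ (n + 1) := by
    induction n with
    | zero =>
      have := hφS ((2 : ℝ) • a 0) (Or.inl ⟨a 0, hat 0, rfl⟩)
      rw [map_smul, smul_eq_mul, abs_mul, abs_two] at this
      norm_num
      linarith
    | succ n ih =>
      have hnorm : ‖a (n + 1) - a n‖ ≤ 2 * (1 / 4 : ℝ) ^ n := by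
        have h₁ := hax n
        have h₂ := hax (n + 1)
        have h₃ : (1 / 4 : ℝ) ^ (n + 1) ≤ (1 / 4 : ℝ) ^ n :=
          pow_le_pow_of_le_one (by norm_num) (by norm_num) n.le_succ
        have h₄ := norm_sub_le_norm_sub_add_norm_sub (a (n + 1)) x (a n)
        rw [norm_sub_rev (a (n + 1)) x] at h₄
        linarith
      have := hφS ((2 : ℝ) ^ (n + 2) • (a (n + 1) - a n)) (Or.inr (Set.mem_iUnion.2
        ⟨n, _, ⟨⟨(a (n + 1), a n), ⟨hat (n + 1), hat n⟩, rfl⟩, hnorm⟩, rfl⟩))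
      rw [map_smul, smul_eq_mul, abs_mul, abs_of_pos (by positivity : (0 : ℝ) < 2 ^ (n + 2)),
        ← le_div_iff₀' (by positivity), map_sub, ← one_div_pow] at this
      have h₅ := abs_sub_abs_le_abs_sub (φ (a (n + 1))) (φ (a n))
      have h₆ : (1 / 2 : ℝ) ^ (n + 1) = 2 * (1 / 2) ^ (n + 2) := by ring
      rw [show n + 1 + 1 = n + 2 from rfl]
      linarith
  have hlim : Tendsto a atTop (𝓝 x) := by
    rw [tendsto_iff_norm_sub_tendsto_zero]
    refine squeeze_zero (fun _ => norm_nonneg _) (fun n => ?_)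
      (tendsto_pow_atTop_nhds_zero_of_lt_one (r := (1 / 4 : ℝ)) (by norm_num) (by norm_num))
    rw [norm_sub_rev]
    exact (hax n).le
  refine le_of_tendsto ((φ.continuous.tendsto x).comp hlim).abs (Eventually.of_forall fun n => ?_)
  exact (hbound n).trans (sub_le_self _ (by positivity))

end NullSequence

/-! ### Total boundedness from weak-star continuity on the ball -/

section TotallyBounded

variable {E : Type*} [NormedAddCommGroup E] [NormedSpace ℝ E]

/-- A bounded set that is arbitrarily close to finite-dimensional subspaces is totally bounded. -/
theorem totallyBounded_of_near_finiteDimensional {P : Set E} (hP : Bornology.IsBounded P)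
    (h : ∀ ε > 0, ∃ V : Submodule ℝ E, FiniteDimensional ℝ V ∧ ∀ p ∈ P, ∃ v ∈ V, ‖p - v‖ < ε) :
    TotallyBounded P := by
  rw [Metric.totallyBounded_iff]
  intro ε hε
  obtain ⟨V, _, hV⟩ := h (ε / 2) (half_pos hε)
  obtain ⟨R, hR⟩ := hP.exists_norm_le
  have : ProperSpace V := FiniteDimensional.proper ℝ V
  have hc : IsCompact ((↑) '' Metric.closedBall (0 : V) (R + ε / 2) : Set E) :=
    (isCompact_closedBall _ _).image continuous_subtype_val
  obtain ⟨t, ht, hVt⟩ := Metric.totallyBounded_iff.1 hc.totallyBounded (ε / 2) (half_pos hε)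
  refine ⟨t, ht, fun p hp => ?_⟩
  obtain ⟨v, hvV, hpv⟩ := hV p hp
  have hv : ‖v‖ ≤ R + ε / 2 := by
    have := norm_le_norm_add_norm_sub p v
    linarith [hR p hp]
  obtain ⟨y, hy, hvy⟩ := Set.mem_iUnion₂.1 (hVt ⟨⟨v, hvV⟩, by simpa using hv, rfl⟩)
  refine Set.mem_iUnion₂.2 ⟨y, hy, ?_⟩
  rw [← dist_eq_norm] at hpv
  rw [Metric.mem_ball] at hvy ⊢
  linarith [dist_triangle p v y]

/-- By Hahn–Banach, a point on which all functionals of norm at most one that vanish on `V` are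
small is near `V`. -/
theorem exists_mem_norm_sub_lt {V : Submodule ℝ E} (hV : IsClosed (V : Set E)) {p : E} {ε ε' : ℝ}
    (hεε' : ε < ε')
    (h : ∀ φ : StrongDual ℝ E, ‖φ‖ ≤ 1 → (∀ v ∈ V, φ v = 0) → |φ p| ≤ ε) :
    ∃ v ∈ V, ‖p - v‖ < ε' := by
  have : IsClosed (V.toAddSubgroup : Set E) := hV
  have hnorm : ‖(Submodule.Quotient.mk p : E ⧸ V)‖ ≤ ε := by
    obtain ⟨g, hg, hgp⟩ := exists_dual_vector'' ℝ (Submodule.Quotient.mk p : E ⧸ V)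
    have hmk : ‖V.mkQL‖ ≤ 1 :=
      ContinuousLinearMap.opNorm_le_bound _ zero_le_one fun x => by
        simpa using Submodule.Quotient.norm_mk_le V x
    have := h (g.comp V.mkQL)
      ((g.opNorm_comp_le _).trans (mul_le_one₀ hg (norm_nonneg _) hmk))
      (fun v hv => by
        have : (Submodule.Quotient.mk v : E ⧸ V) = 0 := (Submodule.Quotient.mk_eq_zero V).2 hv
        simp [this])
    have hval : (g.comp V.mkQL) p = ‖(Submodule.Quotient.mk p : E ⧸ V)‖ := hgp
    rw [hval] at this
    exact (le_abs_self _).trans this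
  obtain ⟨m, hm, hlt⟩ := Submodule.Quotient.norm_mk_lt (S := V) (Submodule.Quotient.mk p)
    (sub_pos.2 hεε')
  refine ⟨p - m, ?_, by simpa using by linarith⟩
  exact (Submodule.Quotient.eq V).1 hm.symm

end TotallyBounded

/-- The norm neighbourhood yields boundedness of `P`, the finite set its finite-dimensional
approximation. -/
theorem mem_nhds_weakStar_zero {X : Type*} [NormedAddCommGroup X] [NormedSpace ℝ X]
    {V : Set (StrongDual ℝ (StrongDual ℝ X))} (hV : V ∈ @nhds _ (weakStar X) 0) :
    V ∈ 𝓝 (0 : StrongDual ℝ (StrongDual ℝ X)) ∧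
      ∃ I : Set (StrongDual ℝ X), I.Finite ∧ ∀ φ : StrongDual ℝ (StrongDual ℝ X),
        (∀ f ∈ I, φ f = 0) → φ ∈ V := by
  rw [nhds_induced] at hV
  obtain ⟨W, hW, hWV⟩ := hV
  constructor
  · exact mem_of_superset
      (NormedSpace.Dual.toWeakDual_continuous.continuousAt.preimage_mem_nhds hW) hWV
  · have h₁ : 𝓝 (StrongDual.toWeakDual (0 : StrongDual ℝ (StrongDual ℝ X))) =
        comap (fun (φ : WeakDual ℝ (StrongDual ℝ X)) (f : StrongDual ℝ X) => φ f)
          (𝓝 fun _ => 0) := nhds_induced _ _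
    rw [h₁, nhds_pi] at hW
    obtain ⟨Z, hZ, hZW⟩ := hW
    obtain ⟨I, hI, s, hs, hIs⟩ := Filter.mem_pi.1 hZ
    refine ⟨I, hI, fun φ hφ => hWV (hZW (hIs fun f hf => ?_))⟩
    have hφs : φ f ∈ s f := by
      rw [hφ f hf]
      exact mem_of_mem_nhds (hs f)
    exact hφs

/-- If uniform convergence on `𝔖` agrees with the weak-star topology on the unit ball of the bidual,
then the members of `𝔖` are totally bounded in norm. -/
theorem totallyBounded_of_induced_eq {X : Type*} [NormedAddCommGroup X] [NormedSpace ℝ X]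
    {𝔖 : Set (Set (StrongDual ℝ X))}
    (h : (uniformConvTopology 𝔖).induced
        (Subtype.val : Metric.closedBall (0 : StrongDual ℝ (StrongDual ℝ X)) 1 → _) =
      (weakStar X).induced
        (Subtype.val : Metric.closedBall (0 : StrongDual ℝ (StrongDual ℝ X)) 1 → _))
    {P : Set (StrongDual ℝ X)} (hP : P ∈ 𝔖) : TotallyBounded P := by
  have key : ∀ ε > 0, ∃ V ∈ @nhds _ (weakStar X) 0,
      ∀ φ ∈ V, ‖φ‖ ≤ 1 → ∀ p ∈ P, |φ p| ≤ ε := by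
    intro ε hε
    have hU : {φ : StrongDual ℝ (StrongDual ℝ X) | ∀ p ∈ P, |φ p - (0 : StrongDual ℝ _) p| < ε} ∈
        @nhds _ (uniformConvTopology 𝔖) 0 :=
      (tendsto_uniformConvTopology_iff (a := id) 𝔖).1 tendsto_id P hP ε hε
    let z : Metric.closedBall (0 : StrongDual ℝ (StrongDual ℝ X)) 1 := ⟨0, by simp⟩
    have hz : comap (Subtype.val : Metric.closedBall (0 : StrongDual ℝ (StrongDual ℝ X)) 1 → _)
        (@nhds _ (uniformConvTopology 𝔖) (z : StrongDual ℝ _)) =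
        comap (Subtype.val : Metric.closedBall (0 : StrongDual ℝ (StrongDual ℝ X)) 1 → _)
          (@nhds _ (weakStar X) (z : StrongDual ℝ _)) := by
      rw [← @nhds_induced _ _ (uniformConvTopology 𝔖), ← @nhds_induced _ _ (weakStar X), h]
    obtain ⟨V, hV, hVU⟩ := hz.ge (preimage_mem_comap hU)
    refine ⟨V, hV, fun φ hφ hφ1 p hp => ?_⟩
    have hball : φ ∈ Metric.closedBall (0 : StrongDual ℝ (StrongDual ℝ X)) 1 :=
      (dist_zero_right φ).trans_le hφ1
    have := @hVU ⟨φ, hball⟩ hφ p hp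
    simpa using this.le
  refine totallyBounded_of_near_finiteDimensional ?_ fun ε hε => ?_
  · obtain ⟨V, hV, hVP⟩ := key 1 one_pos
    have hV0 : V ∈ 𝓝 (0 : StrongDual ℝ (StrongDual ℝ X)) := (mem_nhds_weakStar_zero hV).1
    obtain ⟨r, hr, hrV⟩ := (Metric.nhds_basis_closedBall
      (x := (0 : StrongDual ℝ (StrongDual ℝ X)))).mem_iff.1 hV0
    have hs : 0 < min r 1 := lt_min hr one_pos
    -- A norming functional of `p`, scaled by `min r 1`, lies in both `V` and the unit ball.
    refine isBounded_iff_forall_norm_le.2 ⟨(min r 1)⁻¹, fun p hp => ?_⟩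
    obtain ⟨g, hg, hgp⟩ := exists_dual_vector'' ℝ p
    have hsg : ‖(min r 1) • g‖ ≤ min r 1 := by
      rw [norm_smul, Real.norm_of_nonneg hs.le]
      exact mul_le_of_le_one_right hs.le hg
    have := hVP (min r 1 • g) (hrV (mem_closedBall_zero_iff.2 (hsg.trans (min_le_left _ _))))
      (hsg.trans (min_le_right _ _)) p hp
    rw [smul_apply, hgp, smul_eq_mul, abs_of_nonneg (by positivity)] at this
    rwa [← one_div, le_div_iff₀' hs]
  · obtain ⟨V, hV, hVP⟩ := key (ε / 2) (half_pos hε)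
    obtain ⟨I, hI, hIV⟩ := (mem_nhds_weakStar_zero hV).2
    have hfd : FiniteDimensional ℝ (Submodule.span ℝ I) := FiniteDimensional.span_of_finite ℝ hI
    refine ⟨Submodule.span ℝ I, hfd, fun p hp => ?_⟩
    refine exists_mem_norm_sub_lt (Submodule.closed_of_finiteDimensional _)
      (half_lt_self hε) fun φ hφ hφI => ?_
    exact hVP φ (hIV φ fun f hf => hφI f (Submodule.subset_span hf)) hφ p hp

theorem tauZero_le_normC (X : Type*) [NormedAddCommGroup X] [NormedSpace ℝ X] :
    tauZero X ≤ normC X :=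
  uniformConvTopology_mono fun K hK => ⟨K, fun U hU =>
    (IsCompact.totallyBounded hK) U (norm_uniformSpace_le_uniformConvOn
      (fun _ hS => isBounded_of_isCompact_toWeakSpace hS.2) hU), subset_rfl⟩

theorem normC_le_normN (X : Type*) [NormedAddCommGroup X] [NormedSpace ℝ X] :
    normC X ≤ normN X := by
  refine uniformConvTopology_mono ?_
  rintro _ ⟨u, hu, rfl⟩
  exact ⟨_, hu.isCompact_insert_range, Set.subset_insert _ _⟩

end MackeyBidual

theorem corollary3p9 (X : Type*) [NormedAddCommGroup X] [NormedSpace ℝ X] [CompleteSpace X]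
    (h : ∀ B : Set (StrongDual ℝ (StrongDual ℝ X)), Bornology.IsBounded B →
      (MackeyBidual.tauZero X).induced (Subtype.val : B → StrongDual ℝ (StrongDual ℝ X)) =
        (MackeyBidual.weakStar X).induced (Subtype.val : B → StrongDual ℝ (StrongDual ℝ X))) :
    MackeyBidual.tauZero X = MackeyBidual.normC X ∧
      MackeyBidual.tauZero X = MackeyBidual.normN X := by
  have h₁ := MackeyBidual.tauZero_le_normC X
  have h₂ := MackeyBidual.normC_le_normN X
  have h₃ : MackeyBidual.normN X ≤ MackeyBidual.tauZero X := by
    refine MackeyBidual.uniformConvTopology_le fun P hP => ?_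
    obtain ⟨u, hu, huP⟩ := MackeyBidual.exists_tendsto_zero_polar_subset
      (MackeyBidual.totallyBounded_of_induced_eq (h _ Metric.isBounded_closedBall) hP)
    exact ⟨_, ⟨u, hu, rfl⟩, huP⟩
  exact ⟨le_antisymm h₁ (h₂.trans h₃), le_antisymm (h₁.trans h₂) h₃⟩
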